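/- Let $n\ge 3$ be an integer, let $\lambda$ be a partition of $n$, and let $\rho:S_n\to GL(V)$ be the irreducible complex representation of the symmetric group $S_n$ corresponding to $\lambda$, that is, (up to isomorphism) the Specht module of $\lambda$: the left ideal of $\mathbb{C}[S_n]$ generated by a Young symmetrizer of shape $\lambda$, labelled so that $(n)$ gives the trivial representation and $(1^n)$ the sign representation. Say that $\sigma\in S_n$ is of shape $[a_1^{b_1}\cdots a_k^{b_k}]$, with distinct $a_i$, if its cycle decomposition consists of exactly $b_i$ cycles of length $a_i$ for $i=1,\dots,k$ (fixed points count as cycles of length $1$). Let $\sigma\in S_n$ and assume that one of the following holds: (i) $n\ge 4$ is odd, $\lambda=(2^2,1^{n-4})$ and $\sigma$ is of shape $[(n-2)^1 2^1]$; (ii) $\lambda=(1^n)$ and $\sigma$ is an odd permutation; (iii) $\sigma$ is an $n$-cycle, and either $\lambda=(n-1,1)$, or $n$ is odd and $\lambda=(2,1^{n-2})$; (iv) the pair consisting of $\lambda$ and the shape of $\sigma$ is one of $\big((2^3),[3^1 2^1 1^1]\big)$ with $n=6$, $\big((4^2),[5^1 3^1]\big)$ with $n=8$, $\big((2^4),[5^1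 3^1]\big)$ with $n=8$, $\big((2^5),[5^1 3^1 2^1]\big)$ with $n=10$. Then $1$ is not an eigenvalue of $\rho(\sigma)$. -/

import Mathlib

open scoped MonoidAlgebra

namespace SymmetricGroupRep

/-- The Young diagram of a partition of `n`: the rows, from top to bottom, have as lengths the
parts in decreasing order. A box `(i, j)` lies in row `i` and column `j`, counted from `0`. -/
def diagram {n : ℕ} (lam : n.Partition) : YoungDiagram :=
  YoungDiagram.ofRowLens (lam.parts.sort (· ≥ ·)) (lam.parts.pairwise_sort (· ≥ ·)).sortedGE

/-- A Young tableau of shape `lam`: a bijective filling of the boxes of the diagram with the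
`n` symbols, given as the map which sends each symbol to its box. -/
abbrev Tableau {n : ℕ} (lam : n.Partition) : Type :=
  Fin n ≃ {c : ℕ × ℕ // c ∈ (diagram lam).cells}

/-- The row of a symbol in a tableau. -/
def Tableau.row {n : ℕ} {lam : n.Partition} (T : Tableau lam) (a : Fin n) : ℕ := (T a).1.1

/-- The column of a symbol in a tableau. -/
def Tableau.col {n : ℕ} {lam : n.Partition} (T : Tableau lam) (a : Fin n) : ℕ := (T a).1.2

/-- The permutations that preserve each row of the tableau. -/
def Tableau.rowGroup {n : ℕ} {lam : n.Partition} (T : Tableau lam) :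
    Finset (Equiv.Perm (Fin n)) :=
  Finset.univ.filter fun g => ∀ a, T.row (g a) = T.row a

/-- The permutations that preserve each column of the tableau. -/
def Tableau.colGroup {n : ℕ} {lam : n.Partition} (T : Tableau lam) :
    Finset (Equiv.Perm (Fin n)) :=
  Finset.univ.filter fun g => ∀ a, T.col (g a) = T.col a

/-- The Young symmetrizer: the sum of the permutations in the row group, times the
signed sum of the permutations in the column group. -/
noncomputable def Tableau.symmetrizer {n : ℕ} {lam : n.Partition} (T : Tableau lam) :
    ℂ[Equiv.Perm (Fin n)] :=
  (∑ g ∈ T.rowGroup, MonoidAlgebra.single g (1 : ℂ)) *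
    ∑ g ∈ T.colGroup, MonoidAlgebra.single g ((Equiv.Perm.sign g : ℤ) : ℂ)

/-- The left ideal of the complex group algebra generated by the Young symmetrizer, that is, the
Specht module of the tableau. -/
noncomputable def Tableau.specht {n : ℕ} {lam : n.Partition} (T : Tableau lam) :
    Submodule ℂ[Equiv.Perm (Fin n)] ℂ[Equiv.Perm (Fin n)] :=
  Submodule.span ℂ[Equiv.Perm (Fin n)] {T.symmetrizer}

/-- The symmetric group acting on the Specht module by left multiplication. -/
noncomputable def Tableau.spechtRep {n : ℕ} {lam : n.Partition} (T : Tableau lam) :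
    Representation ℂ (Equiv.Perm (Fin n)) T.specht :=
  Representation.ofModule' T.specht

/-- `ρ` is an irreducible representation corresponding to the partition `lam`: it is isomorphic to
the Specht module of a tableau of shape `lam` (up to isomorphism, all tableaux of one
shape give the same module). With this labelling `(n)` gives the trivial representation and
`(1, …, 1)` gives the sign representation. -/
def CorrespondsTo {n : ℕ} {V : Type*} [AddCommGroup V] [Module ℂ V]
    (ρ : Representation ℂ (Equiv.Perm (Fin n)) V) (lam : n.Partition) : Prop :=
  ∃ T : Tableau lam, Nonempty (ρ.Equiv T.spechtRep)

/-- `σ` has the given multiset of cycle lengths, where fixed points count as cycles of length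
one. -/
def HasShape {n : ℕ} (σ : Equiv.Perm (Fin n)) (s : Multiset ℕ) : Prop :=
  σ.partition.parts = s

end SymmetricGroupRep

/-!
A vector fixed by `σ` in the Specht module of a shape with at most two columns, or at most two
rows, is turned into a function `v` on the `k`-subsets of `Fin n`, where `k` is the length of the
second column or row. The Specht module is thereby realized inside the permutation module on
`k`-subsets, twisted by the sign in the case of columns, as part of the kernel of the map to the
permutation module on `(k - 1)`-subsets: for every `(k - 1)`-subset `B`, the values of `v` at the
`k`-subsets containing `B` add up to zero (`IsHarmonic`). The group element `σ` acts on `v` by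
`1`, respectively by its sign (`IsFixedSpecht.exists_harmonic_of_row`,
`IsFixedSpecht.exists_harmonic_of_col`). Harmonicity holds because the transposition of a symbol
of the second column with its left neighbour is absorbed by the row symmetrizer, while the sign
twist changes sign; rows and columns exchange their roles in the other case. That `v` is nonzero
is immediate for columns, and for rows follows from the positivity of `∑ g, |x g| ^ 2`.

It remains to see that such a `v` vanishes. For one cycle and `k = 1`, `v` is constant with sum
zero. For cycle lengths `5, 3` and `k = 4`, and for cycle lengths `3, 1` and `k = 2`, the
harmonicity relations are an invertible linear system for the values of `v` on the orbits. In
the remaining cases with `k ≥ 1`, `σ` is odd and consists of a transposition and a part of odd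
order on the other points; `eq_zero_of_swap` removes the transposition, lowers `k` by one and
makes the remaining function invariant, which leads back to one of the cases before. For
`(1 ^ n)` one has `k = 0`, and the only value of `v` equals its own negative.
-/

open scoped Pointwise
open Finset Equiv

namespace SymmetricGroupRep

/-! ### Harmonic functions from Specht modules -/

section Harmonic

variable {α : Type*} [DecidableEq α]

/-- A function `v` on finite sets is harmonic of degree `k` on `U` if, for every `(k - 1)`-subset
`B` of `U`, its values at the `k`-subsets of `U` that contain `B` add up to zero. -/
def IsHarmonic (U : Finset α) (k : ℕ) (v : Finset α → ℂ) : Prop :=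
  ∀ B ⊆ U, #B + 1 = k → ∑ b ∈ U \ B, v (insert b B) = 0

variable [Fintype α]

/-- The function on finite sets obtained from a function `w` on permutations by adding up its
values over all permutations that carry `X` to a given set. -/
def cosetSum (X : Finset α) (w : Perm α → ℂ) (A : Finset α) : ℂ :=
  ∑ g with g • X = A, w g

/-- If `g • X = insert b B` with `b ∉ B`, then `b = g y` for a unique `y ∈ X`, and the
remaining elements of `X` go to `B`. -/
lemma sum_cosetSum_insert (X B : Finset α) (w : Perm α → ℂ) :
    ∑ b ∈ univ \ B, cosetSum X w (insert b B) =
      ∑ y ∈ X, ∑ g : Perm α with g • X.erase y = B, w g := by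
  simp only [cosetSum, Finset.sum_filter]
  rw [Finset.sum_comm, Finset.sum_comm (s := X)]
  refine Finset.sum_congr rfl fun g _ => ?_
  have h1 : ∀ b, (b ∈ univ \ B ↔ b ∉ B) := by simp
  rw [← Finset.sum_filter, ← Finset.sum_filter]
  simp only [Finset.sum_const]
  congr 1
  symm
  refine Finset.card_bij (fun y _ => g y) ?_ (fun _ _ _ _ h => g.injective h) ?_
  · intro y hy
    obtain ⟨hyX, rfl⟩ := Finset.mem_filter.1 hy
    refine Finset.mem_filter.2 ⟨?_, ?_⟩
    · rw [h1, ← Perm.smul_def, Finset.smul_mem_smul_finset_iff]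
      simp
    · rw [← Perm.smul_def, ← Finset.smul_finset_insert, Finset.insert_erase hyX]
  · intro b hb
    obtain ⟨hbB, hX⟩ := Finset.mem_filter.1 hb
    rw [h1] at hbB
    have hb' : g • (g⁻¹ b) = b := by simp [Perm.smul_def]
    have hyX : g⁻¹ b ∈ X := by
      rw [← Finset.smul_mem_smul_finset_iff g, hb', hX]
      exact Finset.mem_insert_self _ _
    refine ⟨g⁻¹ b, Finset.mem_filter.2 ⟨hyX, ?_⟩, hb'⟩
    ext c
    have hc : c ∈ g • X.erase (g⁻¹ b) ↔ c ∈ g • X ∧ c ≠ b := by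
      rw [← Finset.inv_smul_mem_iff, ← Finset.inv_smul_mem_iff,
        Finset.mem_erase, and_comm]
      simp [Perm.smul_def]
    rw [hc, hX, Finset.mem_insert]
    constructor
    · rintro ⟨h | h, h'⟩
      · exact absurd h h'
      · exact h
    · exact fun h => ⟨Or.inr h, fun h' => hbB (h' ▸ h)⟩

/-- If `w` changes sign under right multiplication by a transposition which moves `y` out of
`X`, for every `y ∈ X`, then the terms of each harmonicity relation cancel in pairs. -/
lemma isHarmonic_cosetSum (X : Finset α) (w : Perm α → ℂ)
    (hw : ∀ y ∈ X, ∃ z ∉ X, ∀ g, w (g * swap y z) = -w g) (k : ℕ) :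
    IsHarmonic univ k (cosetSum X w) := by
  intro B _ _
  rw [sum_cosetSum_insert]
  refine Finset.sum_eq_zero fun y hy => ?_
  obtain ⟨z, hz, hyz⟩ := hw y hy
  have hs : swap y z • X.erase y = X.erase y := by
    ext c
    rw [← Finset.inv_smul_mem_iff, swap_inv, Perm.smul_def]
    by_cases h1 : c = y
    · subst h1; simp [hz]
    by_cases h2 : c = z
    · subst h2; simp [hz]
    rw [swap_apply_of_ne_of_ne h1 h2]
  have key : ∑ g : Perm α with g • X.erase y = B, w g =
      -∑ g : Perm α with g • X.erase y = B, w g := by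
    rw [← Finset.sum_neg_distrib]
    refine Finset.sum_bij (fun g _ => g * swap y z) ?_ ?_ ?_ ?_
    · intro g hg
      simpa [mul_smul, hs] using hg
    · intro a _ b _ h
      exact mul_right_cancel h
    · intro g hg
      refine ⟨g * swap y z, ?_, by simp [mul_assoc]⟩
      simpa [mul_smul, hs] using hg
    · intro g _
      rw [hyz, neg_neg]
  exact self_eq_neg.1 key

/-- The permutations that preserve every fibre of `f`; the row and column groups of a tableau
are of this form. -/
def fiberPerms (f : α → ℕ) : Finset (Perm α) :=
  univ.filter fun g => ∀ a, f (g a) = f a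

lemma mem_fiberPerms {f : α → ℕ} {g : Perm α} : g ∈ fiberPerms f ↔ ∀ a, f (g a) = f a := by
  simp [fiberPerms]

lemma one_mem_fiberPerms (f : α → ℕ) : 1 ∈ fiberPerms f := mem_fiberPerms.2 fun _ => rfl

lemma mul_mem_fiberPerms {f : α → ℕ} {g h : Perm α} (hg : g ∈ fiberPerms f)
    (hh : h ∈ fiberPerms f) : g * h ∈ fiberPerms f := by
  rw [mem_fiberPerms] at *
  intro a
  rw [Perm.mul_apply, hg, hh]

lemma inv_mem_fiberPerms {f : α → ℕ} {g : Perm α} (hg : g ∈ fiberPerms f) :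
    g⁻¹ ∈ fiberPerms f := by
  rw [mem_fiberPerms] at *
  intro a
  rw [← hg]
  simp

lemma swap_mem_fiberPerms {f : α → ℕ} {y z : α} (h : f y = f z) :
    swap y z ∈ fiberPerms f := by
  rw [mem_fiberPerms]
  intro a
  by_cases h1 : a = y
  · subst h1; simp [h]
  by_cases h2 : a = z
  · subst h2; simp [h]
  rw [swap_apply_of_ne_of_ne h1 h2]

lemma sum_fiberPerms_inv (f : α → ℕ) (F : Perm α → ℂ) :
    ∑ q ∈ fiberPerms f, F q⁻¹ = ∑ q ∈ fiberPerms f, F q :=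
  Finset.sum_bij (fun q _ => q⁻¹) (fun _ h => inv_mem_fiberPerms h)
    (fun _ _ _ _ h => inv_injective h)
    (fun q h => ⟨q⁻¹, inv_mem_fiberPerms h, inv_inv q⟩) (fun _ _ => rfl)

lemma sum_fiberPerms_mul_left {f : α → ℕ} {p : Perm α} (hp : p ∈ fiberPerms f)
    (F : Perm α → ℂ) : ∑ q ∈ fiberPerms f, F (p * q) = ∑ q ∈ fiberPerms f, F q :=
  Finset.sum_bij (fun q _ => p * q) (fun _ h => mul_mem_fiberPerms hp h)
    (fun _ _ _ _ h => mul_left_cancel h)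
    (fun q h => ⟨p⁻¹ * q, mul_mem_fiberPerms (inv_mem_fiberPerms hp) h, by simp⟩)
    (fun _ _ => rfl)

/-- For a function `f` with values in `{0, 1}`, the permutations that carry the fibre over `1`
to a given translate form a left coset of the group preserving the fibres. -/
lemma cosetSum_smul {f : α → ℕ} (hf : ∀ a, f a ≤ 1) {X : Finset α} (hX : ∀ a, a ∈ X ↔ f a = 1)
    (w : Perm α → ℂ) (g : Perm α) :
    cosetSum X w (g • X) = ∑ p ∈ fiberPerms f, w (g * p) := by
  have hmem : ∀ p : Perm α, p • X = X ↔ p ∈ fiberPerms f := by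
    intro p
    rw [mem_fiberPerms]
    constructor
    · intro h a
      have h1 : p • a ∈ p • X ↔ a ∈ X := Finset.smul_mem_smul_finset_iff p
      rw [h, hX, hX, Perm.smul_def] at h1
      have := hf a
      have := hf (p a)
      omega
    · intro h
      ext a
      rw [← Finset.inv_smul_mem_iff, hX, hX, Perm.smul_def, ← h (p⁻¹ a)]
      simp
  symm
  refine Finset.sum_bij (fun p _ => g * p) ?_ (fun _ _ _ _ h => mul_left_cancel h) ?_
    (fun _ _ => rfl)
  · intro p hp
    refine Finset.mem_filter.2 ⟨Finset.mem_univ _, ?_⟩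
    rw [mul_smul, (hmem p).2 hp]
  · intro h hh
    refine ⟨g⁻¹ * h, (hmem _).1 ?_, by simp⟩
    rw [mul_smul, (Finset.mem_filter.1 hh).2, inv_smul_smul]

lemma cosetSum_eq_zero {X A : Finset α} (w : Perm α → ℂ) (h : ∀ g : Perm α, g • X ≠ A) :
    cosetSum X w A = 0 := by
  rw [cosetSum, Finset.filter_false_of_mem fun g _ => h g, Finset.sum_empty]

/-- Equivariance of `cosetSum` only has to be checked on the translates of `X`, because it
vanishes on all other sets. -/
lemma cosetSum_equivariant {X : Finset α} {w : Perm α → ℂ} {σ : Perm α} {c : ℂ}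
    (h : ∀ g : Perm α, cosetSum X w ((σ * g) • X) = c * cosetSum X w (g • X)) (A : Finset α) :
    cosetSum X w (σ • A) = c * cosetSum X w A := by
  by_cases hA : ∃ g : Perm α, g • X = A
  · obtain ⟨g, rfl⟩ := hA
    rw [← mul_smul, h]
  · push Not at hA
    rw [cosetSum_eq_zero w hA, cosetSum_eq_zero, mul_zero]
    intro g hg
    apply hA (σ⁻¹ * g)
    rw [mul_smul, hg, inv_smul_smul]

/-- The sign of a permutation as a complex number. -/
noncomputable def csign (g : Perm α) : ℂ := ((Perm.sign g : ℤ) : ℂ)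

lemma csign_mul (g h : Perm α) : csign (g * h) = csign g * csign h := by
  simp [csign]

lemma csign_inv (g : Perm α) : csign g⁻¹ = csign g := by
  simp [csign]

lemma csign_mul_self (g : Perm α) : csign g * csign g = 1 := by
  rcases Int.units_eq_one_or (Perm.sign g) with h | h <;> simp [csign, h]

lemma csign_swap {y z : α} (h : y ≠ z) : csign (swap y z) = -1 := by
  simp [csign, Perm.sign_swap h]

/-- An element `x` of the left ideal generated by a Young symmetrizer, with `σ * x = x`, as a
function on permutations: `x` arises from a function `s` that is right invariant under the
permutations preserving the rows, by antisymmetrizing over the permutations preserving the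
columns. A tableau enters only through the row `row a` and the column `col a` of each symbol. -/
structure IsFixedSpecht (row col : α → ℕ) (σ : Perm α) (s x : Perm α → ℂ) : Prop where
  row_inv : ∀ g, ∀ t ∈ fiberPerms row, s (g * t) = s g
  eq_sum : ∀ g, x g = ∑ q ∈ fiberPerms col, csign q * s (g * q)
  fixed : ∀ g, x (σ * g) = x g

namespace IsFixedSpecht

variable {row col : α → ℕ} {σ : Perm α} {s x : Perm α → ℂ}

lemma mul_col (H : IsFixedSpecht row col σ s x) (g : Perm α) {t : Perm α}
    (ht : t ∈ fiberPerms col) : x (g * t) = csign t * x g := by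
  rw [H.eq_sum, H.eq_sum, ← sum_fiberPerms_mul_left ht (fun q => csign q * s (g * q)),
    Finset.mul_sum]
  refine Finset.sum_congr rfl fun q _ => ?_
  rw [csign_mul, ← mul_assoc, ← mul_assoc, ← mul_assoc, csign_mul_self, one_mul]

/-- With at most two columns, a nonzero `x` gives a nonzero harmonic function on the sets of the
size of the second column, on which `σ` acts through the sign. -/
theorem exists_harmonic_of_col (H : IsFixedSpecht row col σ s x) (hx : ∃ g, x g ≠ 0)
    (hcol : ∀ a, col a ≤ 1)
    (hmate : ∀ y, col y = 1 → ∃ z, col z = 0 ∧ row y = row z) :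
    ∃ v : Finset α → ℂ, IsHarmonic univ #{a | col a = 1} v ∧
      (∀ A, v (σ • A) = csign σ * v A) ∧ ∃ A, #A = #{a | col a = 1} ∧ v A ≠ 0 := by
  set X : Finset α := {a | col a = 1} with hXdef
  have hX : ∀ a, a ∈ X ↔ col a = 1 := by simp [hXdef]
  have hval : ∀ g : Perm α, cosetSum X (fun g => csign g * s g) (g • X) = csign g * x g := by
    intro g
    rw [cosetSum_smul hcol hX, H.eq_sum, Finset.mul_sum]
    refine Finset.sum_congr rfl fun q _ => ?_
    rw [csign_mul, mul_assoc]
  refine ⟨cosetSum X fun g => csign g * s g, isHarmonic_cosetSum X _ ?_ _,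
    cosetSum_equivariant ?_, ?_⟩
  · intro y hy
    obtain ⟨z, hz, hyz⟩ := hmate y ((hX y).1 hy)
    have hzX : z ∉ X := by rw [hX, hz]; exact zero_ne_one
    refine ⟨z, hzX, fun g => ?_⟩
    rw [H.row_inv g _ (swap_mem_fiberPerms hyz), csign_mul,
      csign_swap (ne_of_mem_of_not_mem hy hzX)]
    ring
  · intro g
    rw [hval, hval, csign_mul, H.fixed, mul_assoc]
  · obtain ⟨g, hg⟩ := hx
    refine ⟨g • X, Finset.card_smul_finset g X, ?_⟩
    rw [hval]
    exact mul_ne_zero (fun h => by simpa [h] using csign_mul_self g) hg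

/-- Right multiplication by the row symmetrizer is injective on the left ideal: if all row sums
of `x` vanish, then `∑ g, |x g| ^ 2` is a multiple of the inner product of `s` with these row
sums, hence zero. -/
lemma eq_zero_of_row_sum (H : IsFixedSpecht row col σ s x)
    (h0 : ∀ g, ∑ p ∈ fiberPerms row, x (g * p) = 0) (g : Perm α) : x g = 0 := by
  have hshift : ∀ (q : Perm α) (F : Perm α → ℂ), ∑ g, F (g * q) = ∑ g, F g := fun q F =>
    Fintype.sum_equiv (Equiv.mulRight q) _ _ fun _ => rfl
  -- As `s` is constant on row cosets, `x` can be averaged over the row group.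
  have hinner : ∑ g, starRingEnd ℂ (x g) * s g = 0 := by
    have h1 : (#(fiberPerms row) : ℂ) * ∑ g, starRingEnd ℂ (x g) * s g = 0 := by
      calc (#(fiberPerms row) : ℂ) * ∑ g, starRingEnd ℂ (x g) * s g
          = ∑ p ∈ fiberPerms row, ∑ g, starRingEnd ℂ (x (g * p)) * s (g * p) := by
            rw [← nsmul_eq_mul, ← Finset.sum_const]
            exact Finset.sum_congr rfl fun p _ =>
              (hshift p fun g => starRingEnd ℂ (x g) * s g).symm
        _ = ∑ g, starRingEnd ℂ (∑ p ∈ fiberPerms row, x (g * p)) * s g := by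
            rw [Finset.sum_comm]
            refine Finset.sum_congr rfl fun g _ => ?_
            rw [map_sum, Finset.sum_mul]
            exact Finset.sum_congr rfl fun p hp => by rw [H.row_inv g p hp]
        _ = 0 := by simp [h0]
    refine (mul_eq_zero.1 h1).resolve_left ?_
    exact_mod_cast Finset.card_ne_zero_of_mem (one_mem_fiberPerms row)
  -- Replacing `s` by `x` here only multiplies the sum by the order of the column group.
  have hsq : ∑ g, starRingEnd ℂ (x g) * x g = 0 := by
    calc ∑ g, starRingEnd ℂ (x g) * x g
        = ∑ q ∈ fiberPerms col, ∑ g, starRingEnd ℂ (x (g * q)) * s (g * q) := by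
          rw [Finset.sum_comm]
          refine Finset.sum_congr rfl fun g _ => ?_
          nth_rw 2 [H.eq_sum]
          rw [Finset.mul_sum]
          refine Finset.sum_congr rfl fun q hq => ?_
          rw [H.mul_col g hq, map_mul]
          simp only [csign, map_intCast]
          ring
      _ = 0 := Finset.sum_eq_zero fun q _ =>
          (hshift q fun g => starRingEnd ℂ (x g) * s g).trans hinner
  have hre : ∑ g, Complex.normSq (x g) = 0 := by
    have : ((∑ g, Complex.normSq (x g) : ℝ) : ℂ) = 0 := by
      rw [← hsq]
      push_cast
      exact Finset.sum_congr rfl fun g _ => Complex.normSq_eq_conj_mul_self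
    exact_mod_cast this
  exact Complex.normSq_eq_zero.1
    ((Finset.sum_eq_zero_iff_of_nonneg fun g _ => Complex.normSq_nonneg _).1 hre g
      (Finset.mem_univ g))

/-- With at most two rows, a nonzero `x` gives a nonzero harmonic function on the sets of the
size of the second row that is invariant under `σ`. -/
theorem exists_harmonic_of_row (H : IsFixedSpecht row col σ s x) (hx : ∃ g, x g ≠ 0)
    (hrow : ∀ a, row a ≤ 1)
    (hmate : ∀ y, row y = 1 → ∃ z, row z = 0 ∧ col y = col z) :
    ∃ v : Finset α → ℂ, IsHarmonic univ #{a | row a = 1} v ∧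
      (∀ A, v (σ • A) = v A) ∧ ∃ A, #A = #{a | row a = 1} ∧ v A ≠ 0 := by
  set X : Finset α := {a | row a = 1} with hXdef
  have hX : ∀ a, a ∈ X ↔ row a = 1 := by simp [hXdef]
  have hval := cosetSum_smul hrow hX x
  refine ⟨cosetSum X x, isHarmonic_cosetSum X _ ?_ _, fun A => ?_, ?_⟩
  · intro y hy
    obtain ⟨z, hz, hyz⟩ := hmate y ((hX y).1 hy)
    have hzX : z ∉ X := by rw [hX, hz]; exact zero_ne_one
    refine ⟨z, hzX, fun g => ?_⟩
    rw [H.mul_col g (swap_mem_fiberPerms hyz), csign_swap (ne_of_mem_of_not_mem hy hzX)]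
    ring
  · rw [cosetSum_equivariant (c := 1) ?_ A, one_mul]
    intro g
    simp only [hval, mul_assoc, H.fixed, one_mul]
  · by_contra hcon
    push Not at hcon
    obtain ⟨g, hg⟩ := hx
    refine hg (H.eq_zero_of_row_sum (fun g => ?_) g)
    rw [← hval]
    exact hcon _ (Finset.card_smul_finset g X)

end IsFixedSpecht

end Harmonic

lemma rowGroup_eq {n : ℕ} {lam : n.Partition} (T : Tableau lam) :
    T.rowGroup = fiberPerms T.row := by
  ext g
  simp [Tableau.rowGroup, mem_fiberPerms]

lemma colGroup_eq {n : ℕ} {lam : n.Partition} (T : Tableau lam) :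
    T.colGroup = fiberPerms T.col := by
  ext g
  simp [Tableau.colGroup, mem_fiberPerms]

/-- An eigenvector for the eigenvalue `1` has the form `h * a * b`, with `a` the row sum and `b`
the signed column sum of a tableau; `s` is `h * a`. -/
theorem exists_isFixedSpecht {n : ℕ} {lam : n.Partition} {V : Type*} [AddCommGroup V]
    [Module ℂ V] {ρ : Representation ℂ (Perm (Fin n)) V} (hρ : CorrespondsTo ρ lam)
    {σ : Perm (Fin n)} (hσ : Module.End.HasEigenvalue (ρ σ) 1) :
    ∃ (T : Tableau lam) (s x : Perm (Fin n) → ℂ),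
      IsFixedSpecht T.row T.col σ s x ∧ ∃ g, x g ≠ 0 := by
  obtain ⟨T, ⟨e⟩⟩ := hρ
  obtain ⟨v, hv⟩ := hσ.exists_hasEigenvector
  have hv1 : ρ σ v = v := by simpa using hv.apply_eq_smul
  obtain ⟨x, hx⟩ : ∃ x, x = e.toLinearEquiv v := ⟨_, rfl⟩
  have hx0 : x ≠ 0 := by
    rw [hx]
    exact fun h => hv.2 (e.toLinearEquiv.map_eq_zero_iff.1 h)
  have hxσ : T.spechtRep σ x = x := by
    rw [hx]
    have := Representation.IntertwiningMap.isIntertwining _ _ e.toIntertwiningMap σ v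
    rw [hv1] at this
    exact this.symm
  have hfix : MonoidAlgebra.single σ (1 : ℂ) * (x : ℂ[Perm (Fin n)]) = x := by
    have := congrArg (Subtype.val) hxσ
    simpa [Tableau.spechtRep, Representation.ofModule'] using this
  obtain ⟨h, hh⟩ := Submodule.mem_span_singleton.1 x.2
  set s : ℂ[Perm (Fin n)] := h * ∑ g ∈ T.rowGroup, MonoidAlgebra.single g (1 : ℂ) with hs
  have hs_eval : ∀ g, s.coeff g = ∑ q ∈ fiberPerms T.row, h.coeff (g * q) := by
    intro g
    rw [← sum_fiberPerms_inv, hs, rowGroup_eq, Finset.mul_sum, MonoidAlgebra.coeff_sum,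
      Finsupp.finsetSum_apply]
    exact Finset.sum_congr rfl fun q _ => by
      rw [MonoidAlgebra.coeff_mul_single_apply, mul_one]
  refine ⟨T, s.coeff, (x : ℂ[Perm (Fin n)]).coeff, ⟨?_, ?_, ?_⟩, ?_⟩
  · intro g t ht
    simp only [hs_eval, mul_assoc]
    exact sum_fiberPerms_mul_left ht fun q => h.coeff (g * q)
  · intro g
    rw [← sum_fiberPerms_inv, ← hh, smul_eq_mul, Tableau.symmetrizer, ← mul_assoc, ← hs,
      colGroup_eq, Finset.mul_sum, MonoidAlgebra.coeff_sum,
      Finsupp.finsetSum_apply]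
    exact Finset.sum_congr rfl fun q _ => by
      rw [MonoidAlgebra.coeff_mul_single_apply, csign_inv, mul_comm, csign]
  · intro g
    conv_lhs => rw [← hfix]
    rw [MonoidAlgebra.coeff_single_mul_apply]
    simp
  · by_contra hcon
    push Not at hcon
    exact hx0 (Subtype.ext (MonoidAlgebra.ext (Finsupp.ext hcon)))

/-! ### Vanishing of invariant harmonic functions -/

section Invariants

variable {α : Type*} [DecidableEq α]

/-- The only function on the `k`-subsets of `U` that is harmonic and invariant under `σ` is
zero. -/
def NoInvariantHarmonic (U : Finset α) (k : ℕ) (σ : Perm α) : Prop :=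
  ∀ v : Finset α → ℂ, IsHarmonic U k v → (∀ A ⊆ U, #A = k → v (σ • A) = v A) →
    ∀ A ⊆ U, #A = k → v A = 0

/-- An invariant function on the points of a single cycle is constant, and harmonicity says that
its values add up to zero. -/
lemma noInvariantHarmonic_one {U : Finset α} {σ : Perm α} (hU : ∀ x ∈ U, σ x ∈ U)
    (htrans : ∀ x ∈ U, ∀ y ∈ U, ∃ i : ℕ, (σ ^ i) x = y) : NoInvariantHarmonic U 1 σ := by
  intro v hv hinv A hA hcard
  obtain ⟨x, rfl⟩ := Finset.card_eq_one.1 hcard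
  have hx : x ∈ U := Finset.singleton_subset_iff.1 hA
  have hpow : ∀ i : ℕ, (σ ^ i) x ∈ U ∧ v {(σ ^ i) x} = v {x} := by
    intro i
    induction i with
    | zero => exact ⟨hx, rfl⟩
    | succ i ih =>
      rw [pow_succ', Perm.mul_apply]
      refine ⟨hU _ ih.1, ?_⟩
      rw [← ih.2, ← hinv _ (Finset.singleton_subset_iff.2 ih.1) (Finset.card_singleton _),
        Finset.smul_finset_singleton, Perm.smul_def]
  have hconst : ∀ y ∈ U, v {y} = v {x} := by
    intro y hy
    obtain ⟨i, rfl⟩ := htrans x hx y hy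
    exact (hpow i).2
  have h := hv ∅ (Finset.empty_subset U) rfl
  rw [Finset.sdiff_empty, Finset.sum_congr rfl (g := fun _ => v {x}) fun b hb => by
    rw [insert_empty_eq, hconst b hb], Finset.sum_const, nsmul_eq_mul] at h
  refine (mul_eq_zero.1 h).resolve_left ?_
  exact_mod_cast Finset.card_ne_zero_of_mem hx

/-- Transport along an embedding that intertwines `τ` with `σ`. -/
lemma NoInvariantHarmonic.map {β : Type*} [DecidableEq β] [Fintype β] {k : ℕ} {τ : Perm β}
    {σ : Perm α} (h : NoInvariantHarmonic (univ : Finset β) k τ) (e : β ↪ α)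
    (he : ∀ i, σ (e i) = e (τ i)) : NoInvariantHarmonic (univ.map e) k σ := by
  intro v hv hinv A hA hcard
  obtain ⟨A, -, rfl⟩ := Finset.subset_map_iff.1 hA
  refine h (fun A => v (A.map e)) ?_ ?_ A (Finset.subset_univ A) (by simpa using hcard)
  · intro B _ hB
    have := hv (B.map e) (Finset.map_subset_map.2 (Finset.subset_univ B)) (by simpa using hB)
    rw [← Finset.map_sdiff, Finset.sum_map] at this
    simpa only [Finset.map_insert] using this
  · intro B _ hB
    rw [← hinv (B.map e) (Finset.map_subset_map.2 (Finset.subset_univ B)) (by simpa using hB)]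
    congr 1
    ext y
    simp only [Finset.mem_map, Finset.mem_smul_finset, Perm.smul_def]
    constructor
    · rintro ⟨_, ⟨b, hb, rfl⟩, rfl⟩
      exact ⟨e b, ⟨b, hb, rfl⟩, he b⟩
    · rintro ⟨_, ⟨b, hb, rfl⟩, rfl⟩
      exact ⟨τ b, ⟨b, hb, rfl⟩, (he b).symm⟩

/-- Suppose that `σ` has odd order on `U` and interchanges two further points `a` and `b`, and
let `v` be harmonic with `σ` acting by `-1`. An odd power of `σ` is the transposition of `a` and
`b`, so `v` vanishes on the sets containing both or neither of them. Hence `A ↦ v (A ∪ {a})` is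
harmonic on `U`, and it is invariant under `σ`, which agrees on `U` with an even power of `σ`
that fixes `a`. -/
lemma eq_zero_of_swap {U : Finset α} {k : ℕ} {σ : Perm α} (h : NoInvariantHarmonic U k σ)
    {a b : α} (hab : a ≠ b) (ha : a ∉ U) (hb : b ∉ U) (hσa : σ a = b) (hσb : σ b = a)
    {N : ℕ} (hN : Odd N) (hUN : ∀ x ∈ U, (σ ^ N) x = x) {v : Finset α → ℂ}
    (hv : IsHarmonic (insert a (insert b U)) (k + 1) v) (hσv : ∀ A, v (σ • A) = -v A)
    {A : Finset α} (hA : A ⊆ insert a (insert b U)) (hcard : #A = k + 1) : v A = 0 := by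
  have hpow : ∀ (i : ℕ) (A : Finset α), v (σ ^ i • A) = (-1) ^ i * v A := by
    intro i A
    induction i with
    | zero => simp
    | succ i ih => rw [pow_succ', mul_smul, hσv, ih, pow_succ]; ring
  have hN' : ∀ A, v (σ ^ N • A) = -v A := fun A => by rw [hpow, hN.neg_one_pow, neg_one_mul]
  have hsq : (σ ^ 2) a = a ∧ (σ ^ 2) b = b := by
    constructor <;> simp [pow_two, Perm.mul_apply, hσa, hσb]
  have hNab : (σ ^ N) a = b ∧ (σ ^ N) b = a := by
    obtain ⟨m, rfl⟩ := hN
    constructor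
    · rw [pow_succ', Perm.mul_apply, pow_mul, Perm.pow_apply_eq_self_of_apply_eq_self hsq.1, hσa]
    · rw [pow_succ', Perm.mul_apply, pow_mul, Perm.pow_apply_eq_self_of_apply_eq_self hsq.2, hσb]
  have hNU : ∀ B ⊆ U, σ ^ N • B = B := by
    intro B hB
    rw [← Finset.coe_inj, Finset.coe_smul_finset]
    ext x
    rw [Set.mem_smul_set]
    constructor
    · rintro ⟨y, hy, rfl⟩
      rwa [Perm.smul_def, hUN y (hB hy)]
    · exact fun hx => ⟨x, hx, hUN x (hB hx)⟩
  have hself : ∀ A, σ ^ N • A = A → v A = 0 := by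
    intro A hA
    have := hN' A
    rw [hA] at this
    exact self_eq_neg.1 this
  have hboth : ∀ B ⊆ U, v (insert a (insert b B)) = 0 := by
    intro B hB
    apply hself
    rw [Finset.smul_finset_insert, Finset.smul_finset_insert, hNU B hB, Perm.smul_def,
      Perm.smul_def, hNab.1, hNab.2, Finset.insert_comm]
  have hone : ∀ B ⊆ U, #B = k → v (insert a B) = 0 := by
    refine h (fun B => v (insert a B)) ?_ ?_
    · intro B hB hBk
      have haB : a ∉ B := fun h => ha (hB h)
      have hbB : b ∉ B := fun h => hb (hB h)
      have := hv (insert a B)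
        (Finset.insert_subset_insert _ (hB.trans (Finset.subset_insert _ _)))
        (by rw [Finset.card_insert_of_notMem haB, hBk])
      have hset : insert a (insert b U) \ insert a B = insert b (U \ B) := by
        ext x
        simp only [Finset.mem_sdiff, Finset.mem_insert]
        grind
      rw [hset, Finset.sum_insert (by simp [hb]), Finset.insert_comm, hboth B hB, zero_add] at this
      rw [← this]
      exact Finset.sum_congr rfl fun x _ => by rw [Finset.insert_comm]
    · intro B hB _
      have h1 : insert a (σ • B) = σ ^ (N + 1) • insert a B := by
        rw [Finset.smul_finset_insert, pow_succ', mul_smul, mul_smul, hNU B hB, Perm.smul_def,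
          Perm.smul_def, hNab.1, hσb]
      rw [h1, hpow, hN.add_one.neg_one_pow, one_mul]
  by_cases haA : a ∈ A
  · have h1 := Finset.insert_erase haA
    by_cases hbA : b ∈ A
    · have h2 : insert b ((A.erase a).erase b) = A.erase a :=
        Finset.insert_erase (Finset.mem_erase.2 ⟨hab.symm, hbA⟩)
      rw [← h1, ← h2]
      refine hboth _ fun x hx => ?_
      have := hA (Finset.mem_of_mem_erase (Finset.mem_of_mem_erase hx))
      grind
    · rw [← h1]
      refine hone _ (fun x hx => ?_) (by rw [Finset.card_erase_of_mem haA, hcard]; rfl)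
      have := hA (Finset.mem_of_mem_erase hx)
      grind
  · by_cases hbA : b ∈ A
    · have h1 := Finset.insert_erase hbA
      have hU : A.erase b ⊆ U := by
        intro x hx
        have := hA (Finset.mem_of_mem_erase hx)
        grind
      rw [← neg_eq_zero, ← hN', ← h1, Finset.smul_finset_insert, hNU _ hU, Perm.smul_def, hNab.2]
      exact hone _ hU (by rw [Finset.card_erase_of_mem hbA, hcard]; rfl)
    · refine hself A (hNU A fun x hx => ?_)
      have := hA hx
      grind

end Invariants

section SmallCases

variable {m k : ℕ} {τ : Perm (Fin m)} {v : Finset (Fin m) → ℂ}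

/-- An invariant function takes equal values on sets in one orbit; the bound `N` makes the
hypothesis decidable. -/
lemma eq_of_exists_pow_smul (hinv : ∀ A ⊆ univ, #A = k → v (τ • A) = v A)
    {A R : Finset (Fin m)} (hR : #R = k) (N : ℕ) (h : ∃ i < N, τ ^ i • R = A) : v A = v R := by
  obtain ⟨i, -, rfl⟩ := h
  induction i with
  | zero => simp
  | succ i ih =>
    rw [pow_succ', mul_smul, hinv _ (Finset.subset_univ _), ih]
    rw [Finset.card_smul_finset, hR]

/-- A permutation of `4` points with cycle lengths `3` and `1`. -/
def perm31 : Perm (Fin 4) := List.formPerm [0, 1, 2]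

/-- A permutation of `8` points with cycle lengths `5` and `3`. -/
def perm53 : Perm (Fin 8) := List.formPerm [0, 1, 2, 3, 4] * List.formPerm [5, 6, 7]

/-- There are two orbits on the sets of size `2`, with representatives `{0, 3}` and `{0, 1}`. -/
lemma noInvariantHarmonic_perm31 : NoInvariantHarmonic (univ : Finset (Fin 4)) 2 perm31 := by
  intro v hv hinv
  have key : ∀ A R : Finset (Fin 4), #R = 2 → (∃ i < 3, perm31 ^ i • R = A) → v A = v R :=
    fun A R hR h => eq_of_exists_pow_smul hinv hR 3 h
  have hb := hv {3} (Finset.subset_univ _) (by decide)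
  have ha := hv {0} (Finset.subset_univ _) (by decide)
  rw [show (univ : Finset (Fin 4)) \ {3} = {0, 1, 2} by decide] at hb
  rw [show (univ : Finset (Fin 4)) \ {0} = {1, 2, 3} by decide] at ha
  simp only [Finset.sum_insert, Finset.sum_singleton, Finset.mem_insert, Finset.mem_singleton,
    Fin.reduceEq, or_self, not_false_eq_true] at ha hb
  rw [key {1, 3} {0, 3} (by decide) (by decide),
    key {2, 3} {0, 3} (by decide) (by decide)] at hb
  rw [key {1, 0} {0, 1} (by decide) (by decide), key {2, 0} {0, 1} (by decide) (by decide),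
    key {3, 0} {0, 3} (by decide) (by decide)] at ha
  have h0 : v {0, 3} = 0 := by linear_combination hb / 3
  have h1 : v {0, 1} = 0 := by linear_combination ha / 2 - h0 / 2
  have hcover : ∀ A : Finset (Fin 4), #A = 2 →
      (∃ i < 3, perm31 ^ i • {0, 3} = A) ∨ (∃ i < 3, perm31 ^ i • {0, 1} = A) := by
    decide
  intro A _ hA
  rcases hcover A hA with h | h
  · rw [key A _ (by decide) h, h0]
  · rw [key A _ (by decide) h, h1]

/-- There are six orbits on the sets of size `4`. The harmonicity relations at representatives of
the six orbits on the sets of size `3` form an invertible linear system for the values there. -/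
lemma noInvariantHarmonic_perm53 : NoInvariantHarmonic (univ : Finset (Fin 8)) 4 perm53 := by
  intro v hv hinv
  have key : ∀ A R : Finset (Fin 8), #R = 4 → (∃ i < 15, perm53 ^ i • R = A) → v A = v R :=
    fun A R hR h => eq_of_exists_pow_smul hinv hR 15 h
  have e1 := hv {5, 6, 7} (Finset.subset_univ _) (by decide)
  have e2 := hv {0, 5, 6} (Finset.subset_univ _) (by decide)
  have e3 := hv {0, 1, 5} (Finset.subset_univ _) (by decide)
  have e4 := hv {0, 2, 5} (Finset.subset_univ _) (by decide)
  have e5 := hv {0, 1, 2} (Finset.subset_univ _) (by decide)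
  have e6 := hv {0, 1, 3} (Finset.subset_univ _) (by decide)
  rw [show (univ : Finset (Fin 8)) \ {5, 6, 7} = {0, 1, 2, 3, 4} by decide] at e1
  rw [show (univ : Finset (Fin 8)) \ {0, 5, 6} = {1, 2, 3, 4, 7} by decide] at e2
  rw [show (univ : Finset (Fin 8)) \ {0, 1, 5} = {2, 3, 4, 6, 7} by decide] at e3
  rw [show (univ : Finset (Fin 8)) \ {0, 2, 5} = {1, 3, 4, 6, 7} by decide] at e4
  rw [show (univ : Finset (Fin 8)) \ {0, 1, 2} = {3, 4, 5, 6, 7} by decide] at e5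
  rw [show (univ : Finset (Fin 8)) \ {0, 1, 3} = {2, 4, 5, 6, 7} by decide] at e6
  simp only [Finset.sum_insert, Finset.sum_singleton, Finset.mem_insert, Finset.mem_singleton,
    Fin.reduceEq, or_self, not_false_eq_true] at e1 e2 e3 e4 e5 e6
  rw [key {1, 5, 6, 7} {0, 5, 6, 7} (by decide) (by decide +kernel),
    key {2, 5, 6, 7} {0, 5, 6, 7} (by decide) (by decide +kernel),
    key {3, 5, 6, 7} {0, 5, 6, 7} (by decide) (by decide +kernel),
    key {4, 5, 6, 7} {0, 5, 6, 7} (by decide) (by decide +kernel)] at e1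
  rw [key {1, 0, 5, 6} {0, 1, 5, 6} (by decide) (by decide +kernel),
    key {2, 0, 5, 6} {0, 2, 5, 6} (by decide) (by decide +kernel),
    key {3, 0, 5, 6} {0, 2, 5, 6} (by decide) (by decide +kernel),
    key {4, 0, 5, 6} {0, 1, 5, 6} (by decide) (by decide +kernel),
    key {7, 0, 5, 6} {0, 5, 6, 7} (by decide) (by decide +kernel)] at e2
  rw [key {2, 0, 1, 5} {0, 1, 2, 5} (by decide) (by decide +kernel),
    key {3, 0, 1, 5} {0, 1, 3, 5} (by decide) (by decide +kernel),
    key {4, 0, 1, 5} {0, 1, 2, 5} (by decide) (by decide +kernel),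
    key {6, 0, 1, 5} {0, 1, 5, 6} (by decide) (by decide +kernel),
    key {7, 0, 1, 5} {0, 1, 5, 6} (by decide) (by decide +kernel)] at e3
  rw [key {1, 0, 2, 5} {0, 1, 2, 5} (by decide) (by decide +kernel),
    key {3, 0, 2, 5} {0, 1, 3, 5} (by decide) (by decide +kernel),
    key {4, 0, 2, 5} {0, 1, 3, 5} (by decide) (by decide +kernel),
    key {6, 0, 2, 5} {0, 2, 5, 6} (by decide) (by decide +kernel),
    key {7, 0, 2, 5} {0, 2, 5, 6} (by decide) (by decide +kernel)] at e4
  rw [key {3, 0, 1, 2} {0, 1, 2, 3} (by decide) (by decide +kernel),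
    key {4, 0, 1, 2} {0, 1, 2, 3} (by decide) (by decide +kernel),
    key {5, 0, 1, 2} {0, 1, 2, 5} (by decide) (by decide +kernel),
    key {6, 0, 1, 2} {0, 1, 2, 5} (by decide) (by decide +kernel),
    key {7, 0, 1, 2} {0, 1, 2, 5} (by decide) (by decide +kernel)] at e5
  rw [key {2, 0, 1, 3} {0, 1, 2, 3} (by decide) (by decide +kernel),
    key {4, 0, 1, 3} {0, 1, 2, 3} (by decide) (by decide +kernel),
    key {5, 0, 1, 3} {0, 1, 3, 5} (by decide) (by decide +kernel),
    key {6, 0, 1, 3} {0, 1, 3, 5} (by decide) (by decide +kernel),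
    key {7, 0, 1, 3} {0, 1, 3, 5} (by decide) (by decide +kernel)] at e6
  have h1 : v {0, 5, 6, 7} = 0 := by linear_combination e1 / 5
  have h2 : v {0, 1, 2, 5} = v {0, 1, 3, 5} := by linear_combination (e5 - e6) / 3
  have h3 : v {0, 1, 3, 5} = 0 := by
    linear_combination (e3 + e4 - e2 + h1 - 3 * h2) / 6
  have h4 : v {0, 1, 2, 5} = 0 := h2.trans h3
  have h5 : v {0, 1, 2, 3} = 0 := by linear_combination (e6 - 3 * h3) / 2
  have h6 : v {0, 1, 5, 6} = 0 := by linear_combination (e3 - 2 * h4 - h3) / 2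
  have h7 : v {0, 2, 5, 6} = 0 := by linear_combination (e4 - h4 - 2 * h3) / 2
  have hcover : ∀ A ∈ (univ : Finset (Fin 8)).powersetCard 4,
      ∃ R ∈ ([{0, 1, 2, 3}, {0, 1, 2, 5}, {0, 1, 3, 5}, {0, 1, 5, 6}, {0, 2, 5, 6},
        {0, 5, 6, 7}] : List (Finset (Fin 8))), ∃ i < 15, perm53 ^ i • R = A := by
    decide +kernel
  intro A hA hcard
  obtain ⟨R, hR, h⟩ := hcover A (Finset.mem_powersetCard.2 ⟨hA, hcard⟩)
  simp only [List.mem_cons, List.not_mem_nil, or_false] at hR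
  rcases hR with rfl | rfl | rfl | rfl | rfl | rfl
  · rw [key A _ (by decide) h, h5]
  · rw [key A _ (by decide) h, h4]
  · rw [key A _ (by decide) h, h3]
  · rw [key A _ (by decide) h, h6]
  · rw [key A _ (by decide) h, h7]
  · rw [key A _ (by decide) h, h1]

end SmallCases

/-! ### Diagrams with two rows or two columns -/

section Diagrams

variable {n : ℕ} {lam : n.Partition}

lemma mem_diagram_of_sort_eq {w : List ℕ} (hw : w.SortedGE) (h : lam.parts = ↑w) (c : ℕ × ℕ) :
    c ∈ (diagram lam).cells ↔ ∃ h : c.1 < w.length, c.2 < w.get ⟨c.1, h⟩ := by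
  have hsort : lam.parts.sort (· ≥ ·) = w := by
    rw [h]
    refine List.Perm.eq_of_pairwise (le := (· ≥ ·)) (fun a b _ _ h1 h2 => le_antisymm h2 h1)
      (Multiset.pairwise_sort _ _) hw.pairwise ?_
    exact Multiset.coe_eq_coe.1 (Multiset.sort_eq _ _)
  rw [YoungDiagram.mem_cells, diagram, YoungDiagram.mem_ofRowLens]
  simp only [hsort, List.get_eq_getElem]

lemma mem_diagram_two_rows {p q : ℕ} (hqp : q ≤ p) (h : lam.parts = {p, q}) (i j : ℕ) :
    (i, j) ∈ (diagram lam).cells ↔ (i = 0 ∧ j < p) ∨ (i = 1 ∧ j < q) := by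
  rw [mem_diagram_of_sort_eq (w := [p, q]) (by simpa [List.sortedGE_iff_pairwise] using hqp)
    (by rw [h]; rfl)]
  rcases i with _ | _ | i <;> simp

/-- Boxes of a diagram with `k` rows of length `2` followed by `m` rows of length `1`; the second
alternative describes the whole first column. -/
lemma mem_diagram_two_cols {k m : ℕ}
    (h : lam.parts = Multiset.replicate k 2 + Multiset.replicate m 1) (i j : ℕ) :
    (i, j) ∈ (diagram lam).cells ↔ (i < k ∧ j < 2) ∨ (i < k + m ∧ j < 1) := by
  rw [mem_diagram_of_sort_eq (w := List.replicate k 2 ++ List.replicate m 1) ?_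
    (by rw [h, ← Multiset.coe_replicate, ← Multiset.coe_replicate, Multiset.coe_add])]
  · simp only [List.length_append, List.length_replicate, List.get_eq_getElem, List.getElem_append,
      List.getElem_replicate]
    constructor
    · rintro ⟨h1, h2⟩
      split_ifs at h2 <;> omega
    · rintro (⟨h1, h2⟩ | ⟨h1, h2⟩)
      · exact ⟨by omega, by rwa [dif_pos h1]⟩
      · exact ⟨h1, by split_ifs <;> omega⟩
  · rw [List.sortedGE_iff_pairwise, List.pairwise_append]
    refine ⟨List.pairwise_replicate.2 (Or.inr le_rfl),
      List.pairwise_replicate.2 (Or.inr le_rfl), ?_⟩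
    intro a ha b hb
    rw [List.eq_of_mem_replicate ha, List.eq_of_mem_replicate hb]
    norm_num

variable (T : Tableau lam)

lemma row_col_mem (a : Fin n) : (T.row a, T.col a) ∈ (diagram lam).cells := (T a).2

lemma exists_row_col {i j : ℕ} (h : (i, j) ∈ (diagram lam).cells) :
    ∃ a, T.row a = i ∧ T.col a = j :=
  ⟨T.symm ⟨(i, j), h⟩, by simp [Tableau.row], by simp [Tableau.col]⟩

lemma eq_of_row_col {a b : Fin n} (h1 : T.row a = T.row b) (h2 : T.col a = T.col b) : a = b :=
  T.injective (Subtype.ext (Prod.ext h1 h2))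

variable {V : Type*} [AddCommGroup V] [Module ℂ V] {ρ : Representation ℂ (Perm (Fin n)) V}
  {σ : Perm (Fin n)}

theorem exists_harmonic_of_two_rows (hρ : CorrespondsTo ρ lam)
    (hσ : Module.End.HasEigenvalue (ρ σ) 1) {p q : ℕ} (hqp : q ≤ p) (h : lam.parts = {p, q}) :
    ∃ v : Finset (Fin n) → ℂ, IsHarmonic univ q v ∧ (∀ A, v (σ • A) = v A) ∧
      ∃ A, #A = q ∧ v A ≠ 0 := by
  obtain ⟨T, s, x, H, hx⟩ := exists_isFixedSpecht hρ hσ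
  have hmem := mem_diagram_two_rows hqp h
  have hcard : #{a | T.row a = 1} = q := by
    rw [← Finset.card_range q]
    refine Finset.card_bij (fun a _ => T.col a) ?_ ?_ ?_
    · intro a ha
      have := (hmem _ _).1 (row_col_mem T a)
      rw [Finset.mem_filter] at ha
      rw [Finset.mem_range]
      omega
    · intro a ha b hb hab
      rw [Finset.mem_filter] at ha hb
      exact eq_of_row_col T (ha.2.trans hb.2.symm) hab
    · intro j hj
      rw [Finset.mem_range] at hj
      obtain ⟨a, ha⟩ := exists_row_col T ((hmem 1 j).2 (Or.inr ⟨rfl, hj⟩))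
      exact ⟨a, by simpa using ha.1, ha.2⟩
  have := H.exists_harmonic_of_row hx ?_ ?_
  · rwa [hcard] at this
  · intro a
    have := (hmem _ _).1 (row_col_mem T a)
    omega
  · intro y hy
    have h1 := (hmem _ _).1 (row_col_mem T y)
    obtain ⟨z, hz⟩ := exists_row_col T ((hmem 0 (T.col y)).2 (Or.inl ⟨rfl, by omega⟩))
    exact ⟨z, hz.1, hz.2.symm⟩

theorem exists_harmonic_of_two_cols (hρ : CorrespondsTo ρ lam)
    (hσ : Module.End.HasEigenvalue (ρ σ) 1) {k m : ℕ}
    (h : lam.parts = Multiset.replicate k 2 + Multiset.replicate m 1) :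
    ∃ v : Finset (Fin n) → ℂ, IsHarmonic univ k v ∧ (∀ A, v (σ • A) = csign σ * v A) ∧
      ∃ A, #A = k ∧ v A ≠ 0 := by
  obtain ⟨T, s, x, H, hx⟩ := exists_isFixedSpecht hρ hσ
  have hmem := mem_diagram_two_cols h
  have hcard : #{a | T.col a = 1} = k := by
    rw [← Finset.card_range k]
    refine Finset.card_bij (fun a _ => T.row a) ?_ ?_ ?_
    · intro a ha
      have := (hmem _ _).1 (row_col_mem T a)
      rw [Finset.mem_filter] at ha
      rw [Finset.mem_range]
      omega
    · intro a ha b hb hab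
      rw [Finset.mem_filter] at ha hb
      exact eq_of_row_col T hab (ha.2.trans hb.2.symm)
    · intro i hi
      rw [Finset.mem_range] at hi
      obtain ⟨a, ha⟩ := exists_row_col T ((hmem i 1).2 (Or.inl ⟨hi, one_lt_two⟩))
      exact ⟨a, by simpa using ha.2, ha.1⟩
  have := H.exists_harmonic_of_col hx ?_ ?_
  · rwa [hcard] at this
  · intro a
    have := (hmem _ _).1 (row_col_mem T a)
    omega
  · intro y hy
    have h1 := (hmem _ _).1 (row_col_mem T y)
    obtain ⟨z, hz⟩ := exists_row_col T ((hmem (T.row y) 0).2 (by omega))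
    exact ⟨z, hz.2, hz.1.symm⟩

end Diagrams

/-! ### Cycle types -/

section Shapes

lemma HasShape.cycleType_eq {n : ℕ} {σ : Perm (Fin n)} {s : Multiset ℕ} (h : HasShape σ s) :
    σ.cycleType = s.filter (2 ≤ ·) := by
  rw [← h, Perm.filter_parts_partition_eq_cycleType]

lemma csign_eq_of_cycleType {n : ℕ} {σ : Perm (Fin n)} {s : Multiset ℕ} (h : σ.cycleType = s) :
    csign σ = (-1) ^ (s.sum + s.card) := by
  rw [csign, Perm.sign_of_cycleType, h]
  simp

lemma noInvariantHarmonic_of_cycleType_singleton {n : ℕ} {σ : Perm (Fin n)}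
    (h : σ.cycleType = {n}) : NoInvariantHarmonic univ 1 σ := by
  have hc : σ.IsCycle := Perm.card_cycleType_eq_one.1 (by rw [h, Multiset.card_singleton])
  have hsupp : σ.support = univ := by
    rw [← Finset.card_eq_iff_eq_univ, ← Perm.sum_cycleType, h, Multiset.sum_singleton,
      Fintype.card_fin]
  have hne : ∀ x, σ x ≠ x := fun x => Perm.mem_support.1 (hsupp ▸ Finset.mem_univ x)
  exact noInvariantHarmonic_one (fun _ _ => Finset.mem_univ _)
    fun x _ y _ => hc.exists_pow_eq (hne x) (hne y)

/-- The case of an odd cycle together with a transposition, on the sets of size `2`. -/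
lemma eq_zero_of_cycleType_pair {n : ℕ} (hn : 4 ≤ n) (hodd : Odd n) {σ : Perm (Fin n)}
    (h : σ.cycleType = {n - 2, 2}) {v : Finset (Fin n) → ℂ} (hv : IsHarmonic univ 2 v)
    (hσv : ∀ A, v (σ • A) = -v A) {A : Finset (Fin n)} (hA : #A = 2) : v A = 0 := by
  obtain ⟨c, τ, rfl, hd, -, hc2⟩ :=
    Perm.mem_cycleType_iff.1 (show 2 ∈ σ.cycleType by simp [h])
  obtain ⟨a, b, hab, rfl⟩ := Perm.card_support_eq_two.1 hc2
  have hτ : τ.cycleType = {n - 2} := by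
    have hs : (swap a b).cycleType = {2} := by
      rw [(Perm.isCycle_swap hab).cycleType, Perm.card_support_swap hab]
    rw [hd.cycleType_mul, hs, Multiset.insert_eq_cons, ← Multiset.singleton_add, add_comm] at h
    exact add_right_cancel h
  have hcyc : τ.IsCycle := Perm.card_cycleType_eq_one.1 (by rw [hτ, Multiset.card_singleton])
  have hcard : #τ.support = n - 2 := by
    rw [← Perm.sum_cycleType, hτ, Multiset.sum_singleton]
  have hda : τ a = a := (hd a).resolve_left (by simpa using hab.symm)
  have hdb : τ b = b := (hd b).resolve_left (by simpa using hab)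
  have ha : a ∉ τ.support := by simpa using hda
  have hb : b ∉ τ.support := by simpa using hdb
  have hswap : ∀ x ∈ τ.support, swap a b x = x := fun x hx =>
    (hd x).resolve_right (Perm.mem_support.1 hx)
  have hστ : ∀ x ∈ τ.support, (swap a b * τ) x = τ x := fun x hx =>
    hswap _ (Perm.apply_mem_support.2 hx)
  have hpow : ∀ x ∈ τ.support, ∀ i : ℕ, ((swap a b * τ) ^ i) x = (τ ^ i) x := by
    intro x hx i
    induction i with
    | zero => rfl
    | succ i ih =>
      rw [pow_succ', pow_succ', Perm.mul_apply, Perm.mul_apply, ih]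
      exact hστ _ (Perm.pow_apply_mem_support.2 hx)
  have huniv : insert a (insert b τ.support) = univ := by
    rw [← Finset.card_eq_iff_eq_univ, Finset.card_insert_of_notMem,
      Finset.card_insert_of_notMem hb,
      hcard, Fintype.card_fin]
    · omega
    · simp only [Finset.mem_insert, not_or]
      exact ⟨hab, ha⟩
  have hN : Odd (n - 2) := by
    obtain ⟨m, rfl⟩ := hodd
    exact ⟨m - 1, by omega⟩
  refine eq_zero_of_swap (k := 1) (U := τ.support) (N := n - 2) (σ := swap a b * τ)
    (noInvariantHarmonic_one ?_ ?_) hab ha hb ?_ ?_ hN ?_ (huniv ▸ hv) hσv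
    (huniv ▸ Finset.subset_univ A) hA
  · intro x hx
    rw [hστ x hx]
    exact Perm.apply_mem_support.2 hx
  · intro x hx y hy
    obtain ⟨i, hi⟩ := hcyc.exists_pow_eq (Perm.mem_support.1 hx) (Perm.mem_support.1 hy)
    exact ⟨i, by rw [hpow x hx, hi]⟩
  · rw [Perm.mul_apply, hda, swap_apply_left]
  · rw [Perm.mul_apply, hdb, swap_apply_right]
  · intro x hx
    rw [hpow x hx, ← hcard, ← hcyc.orderOf, pow_orderOf_eq_one, Perm.one_apply]

lemma exists_conj_apply {n : ℕ} {σ τ : Perm (Fin n)} (h : σ.cycleType = τ.cycleType) :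
    ∃ π : Perm (Fin n), ∀ x, σ (π x) = π (τ x) := by
  obtain ⟨π, hπ⟩ := isConj_iff.1 (Perm.isConj_iff_cycleType_eq.2 h.symm)
  exact ⟨π, fun x => by rw [← hπ]; simp⟩

lemma NoInvariantHarmonic.of_cycleType {n k : ℕ} {σ τ : Perm (Fin n)}
    (h : NoInvariantHarmonic univ k τ) (hστ : σ.cycleType = τ.cycleType) :
    NoInvariantHarmonic univ k σ := by
  obtain ⟨π, hπ⟩ := exists_conj_apply hστ
  have := h.map π.toEmbedding hπ
  rwa [Finset.map_univ_equiv] at this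

/-- The reduction `eq_zero_of_swap` for a permutation of `Fin (m + 2)` that has the cycle type of a
given permutation `τ` of odd order on `Fin m`, extended by the transposition of the last two
points. -/
lemma eq_zero_of_cycleType_extend {m k N : ℕ} {τ : Perm (Fin m)} (hN : Odd N) (hτN : τ ^ N = 1)
    (h : NoInvariantHarmonic univ k τ) {τ' σ : Perm (Fin (m + 2))}
    (hτ' : ∀ i, τ' (Fin.castAdd 2 i) = Fin.castAdd 2 (τ i))
    (h0 : τ' (Fin.natAdd m 0) = Fin.natAdd m 1) (h1 : τ' (Fin.natAdd m 1) = Fin.natAdd m 0)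
    (hσ : σ.cycleType = τ'.cycleType) {v : Finset (Fin (m + 2)) → ℂ}
    (hv : IsHarmonic univ (k + 1) v) (hσv : ∀ A, v (σ • A) = -v A) {A : Finset (Fin (m + 2))}
    (hA : #A = k + 1) : v A = 0 := by
  obtain ⟨π, hπ⟩ := exists_conj_apply hσ
  set e : Fin m ↪ Fin (m + 2) := (Fin.castAddEmb 2).trans π.toEmbedding with he
  have he_apply : ∀ i, e i = π (Fin.castAdd 2 i) := fun i => rfl
  have hσe : ∀ i, σ (e i) = e (τ i) := fun i => by rw [he_apply, he_apply, hπ, hτ']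
  have hpow : ∀ (j : ℕ) (i : Fin m), (σ ^ j) (e i) = e ((τ ^ j) i) := by
    intro j i
    induction j with
    | zero => rfl
    | succ j ih => rw [pow_succ', pow_succ', Perm.mul_apply, Perm.mul_apply, ih, hσe]
  have hnot : ∀ j, π (Fin.natAdd m j) ∉ univ.map e := by
    intro j hj
    obtain ⟨i, -, hi⟩ := Finset.mem_map.1 hj
    have := congrArg Fin.val (π.injective hi)
    simp at this
    omega
  have huniv : insert (π (Fin.natAdd m 0)) (insert (π (Fin.natAdd m 1)) (univ.map e)) = univ := by
    refine Finset.eq_univ_iff_forall.2 fun x => ?_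
    obtain ⟨y, rfl⟩ := π.surjective x
    refine Fin.addCases (fun i => ?_) (fun j => ?_) y
    · exact Finset.mem_insert_of_mem (Finset.mem_insert_of_mem
        (Finset.mem_map_of_mem e (Finset.mem_univ i)))
    · fin_cases j
      · exact Finset.mem_insert_self _ _
      · exact Finset.mem_insert_of_mem (Finset.mem_insert_self _ _)
  refine eq_zero_of_swap (h.map e hσe) (π.injective.ne ?_) (hnot 0) (hnot 1) ?_ ?_ hN ?_
    (huniv ▸ hv) hσv (huniv ▸ Finset.subset_univ A) hA
  · simp [Fin.ext_iff]
  · rw [hπ, h0]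
  · rw [hπ, h1]
  · intro x hx
    obtain ⟨i, -, rfl⟩ := Finset.mem_map.1 hx
    rw [hpow, hτN, Perm.one_apply]

/-- A permutation of `6` points with cycle lengths `3`, `1` and `2`: the permutation `perm31`,
extended by a transposition of the last two points. -/
def perm312 : Perm (Fin 6) := List.formPerm [0, 1, 2] * List.formPerm [4, 5]

/-- A permutation of `10` points with cycle lengths `5`, `3` and `2`: the permutation `perm53`,
extended by a transposition of the last two points. -/
def perm532 : Perm (Fin 10) :=
  List.formPerm [0, 1, 2, 3, 4] * List.formPerm [5, 6, 7] * List.formPerm [8, 9]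

lemma cycleType_formPerm {n : ℕ} {l : List (Fin n)} (hl : l.Nodup) (h2 : 2 ≤ l.length) :
    l.formPerm.cycleType = {l.length} := by
  rw [(List.isCycle_formPerm hl h2).cycleType, List.support_formPerm_of_nodup l hl,
    List.toFinset_card_of_nodup hl]
  rintro x rfl
  simp at h2

lemma cycleType_perm53 : perm53.cycleType = {5, 3} := by
  rw [perm53, Perm.Disjoint.cycleType_mul (by unfold Perm.Disjoint; decide),
    cycleType_formPerm (by decide) (by decide),
    cycleType_formPerm (by decide) (by decide)]
  rfl

lemma cycleType_perm312 : perm312.cycleType = {3, 2} := by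
  rw [perm312, Perm.Disjoint.cycleType_mul (by unfold Perm.Disjoint; decide),
    cycleType_formPerm (by decide) (by decide),
    cycleType_formPerm (by decide) (by decide)]
  rfl

lemma cycleType_perm532 : perm532.cycleType = {5, 3, 2} := by
  rw [perm532, Perm.Disjoint.cycleType_mul (by unfold Perm.Disjoint; decide),
    Perm.Disjoint.cycleType_mul (by unfold Perm.Disjoint; decide),
    cycleType_formPerm (by decide) (by decide),
    cycleType_formPerm (by decide) (by decide),
    cycleType_formPerm (by decide) (by decide)]
  rfl

end Shapes

end SymmetricGroupRep

open SymmetricGroupRep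

theorem proposition1 (n : ℕ) (hn : 3 ≤ n) (lam : n.Partition) {V : Type*} [AddCommGroup V]
    [Module ℂ V] (ρ : Representation ℂ (Equiv.Perm (Fin n)) V)
    (hρ : SymmetricGroupRep.CorrespondsTo ρ lam) (σ : Equiv.Perm (Fin n))
    (hpair :
      (4 ≤ n ∧ Odd n ∧ lam.parts = Multiset.replicate 2 2 + Multiset.replicate (n - 4) 1 ∧
        SymmetricGroupRep.HasShape σ {n - 2, 2}) ∨
      (lam.parts = Multiset.replicate n 1 ∧ Equiv.Perm.sign σ = -1) ∨
      (SymmetricGroupRep.HasShape σ {n} ∧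
        (lam.parts = {n - 1, 1} ∨
          (Odd n ∧ lam.parts = {2} + Multiset.replicate (n - 2) 1))) ∨
      (n = 6 ∧ lam.parts = {2, 2, 2} ∧ SymmetricGroupRep.HasShape σ {3, 2, 1}) ∨
      (n = 8 ∧ lam.parts = {4, 4} ∧ SymmetricGroupRep.HasShape σ {5, 3}) ∨
      (n = 8 ∧ lam.parts = {2, 2, 2, 2} ∧ SymmetricGroupRep.HasShape σ {5, 3}) ∨
      (n = 10 ∧ lam.parts = {2, 2, 2, 2, 2} ∧ SymmetricGroupRep.HasShape σ {5, 3, 2})) :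
    ¬ Module.End.HasEigenvalue (ρ σ) 1 := by
  intro hσ
  rcases hpair with ⟨h4, hodd, hlam, hs⟩ | ⟨hlam, hs⟩ | ⟨hs, hlam | ⟨hodd, hlam⟩⟩ |
    ⟨rfl, hlam, hs⟩ | ⟨rfl, hlam, hs⟩ | ⟨rfl, hlam, hs⟩ | ⟨rfl, hlam, hs⟩
  · obtain ⟨v, hv, hσv, A, hA, hvA⟩ := exists_harmonic_of_two_cols hρ hσ hlam
    have hct : σ.cycleType = {n - 2, 2} := by
      rw [hs.cycleType_eq]
      refine Multiset.filter_eq_self.2 fun a ha => ?_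
      simp only [Multiset.insert_eq_cons, Multiset.mem_cons, Multiset.mem_singleton] at ha
      omega
    have hsign : csign σ = -1 := by
      rw [csign_eq_of_cycleType hct]
      refine Odd.neg_one_pow ?_
      obtain ⟨m, rfl⟩ := hodd
      refine ⟨m + 1, ?_⟩
      simp
      omega
    simp only [hsign, neg_one_mul] at hσv
    exact hvA (eq_zero_of_cycleType_pair h4 hodd hct hv hσv hA)
  · obtain ⟨v, -, hσv, A, hA, hvA⟩ :=
      exists_harmonic_of_two_cols (k := 0) (m := n) hρ hσ (by rw [hlam]; simp)
    rw [Finset.card_eq_zero] at hA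
    subst hA
    have := hσv ∅
    rw [Finset.smul_finset_empty, csign, hs] at this
    exact hvA (self_eq_neg.1 (by simpa using this))
  · obtain ⟨v, hv, hσv, A, hA, hvA⟩ := exists_harmonic_of_two_rows hρ hσ (by omega) hlam
    have hct : σ.cycleType = {n} := by
      rw [hs.cycleType_eq]
      exact Multiset.filter_eq_self.2 fun a ha => by rw [Multiset.mem_singleton.1 ha]; omega
    exact hvA (noInvariantHarmonic_of_cycleType_singleton hct v hv (fun A _ _ => hσv A) A
      (Finset.subset_univ A) hA)
  · obtain ⟨v, hv, hσv, A, hA, hvA⟩ :=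
      exists_harmonic_of_two_cols (k := 1) (m := n - 2) hρ hσ (by rw [hlam]; simp)
    have hct : σ.cycleType = {n} := by
      rw [hs.cycleType_eq]
      exact Multiset.filter_eq_self.2 fun a ha => by rw [Multiset.mem_singleton.1 ha]; omega
    have hsign : csign σ = 1 := by
      rw [csign_eq_of_cycleType hct]
      exact Even.neg_one_pow (by simpa using hodd.add_one)
    simp only [hsign, one_mul] at hσv
    exact hvA (noInvariantHarmonic_of_cycleType_singleton hct v hv (fun A _ _ => hσv A) A
      (Finset.subset_univ A) hA)
  · obtain ⟨v, hv, hσv, A, hA, hvA⟩ :=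
      exists_harmonic_of_two_cols (k := 3) (m := 0) hρ hσ (by rw [hlam]; rfl)
    have hct : σ.cycleType = {3, 2} := by rw [hs.cycleType_eq]; rfl
    have hsign : csign σ = -1 := by
      rw [csign_eq_of_cycleType hct]
      exact Odd.neg_one_pow (by decide)
    simp only [hsign, neg_one_mul] at hσv
    exact hvA (eq_zero_of_cycleType_extend (N := 3) (τ' := perm312) (by decide) (by decide)
      noInvariantHarmonic_perm31 (by decide) (by decide) (by decide)
      (hct.trans cycleType_perm312.symm) hv hσv hA)
  · obtain ⟨v, hv, hσv, A, hA, hvA⟩ := exists_harmonic_of_two_rows hρ hσ le_rfl hlam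
    have hct : σ.cycleType = {5, 3} := by rw [hs.cycleType_eq]; rfl
    exact hvA (noInvariantHarmonic_perm53.of_cycleType (hct.trans cycleType_perm53.symm) v hv
      (fun A _ _ => hσv A) A (Finset.subset_univ A) hA)
  · obtain ⟨v, hv, hσv, A, hA, hvA⟩ :=
      exists_harmonic_of_two_cols (k := 4) (m := 0) hρ hσ (by rw [hlam]; rfl)
    have hct : σ.cycleType = {5, 3} := by rw [hs.cycleType_eq]; rfl
    have hsign : csign σ = 1 := by
      rw [csign_eq_of_cycleType hct]
      exact Even.neg_one_pow (by decide)
    simp only [hsign, one_mul] at hσv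
    exact hvA (noInvariantHarmonic_perm53.of_cycleType (hct.trans cycleType_perm53.symm) v hv
      (fun A _ _ => hσv A) A (Finset.subset_univ A) hA)
  · obtain ⟨v, hv, hσv, A, hA, hvA⟩ :=
      exists_harmonic_of_two_cols (k := 5) (m := 0) hρ hσ (by rw [hlam]; rfl)
    have hct : σ.cycleType = {5, 3, 2} := by rw [hs.cycleType_eq]; rfl
    have hsign : csign σ = -1 := by
      rw [csign_eq_of_cycleType hct]
      exact Odd.neg_one_pow (by decide)
    simp only [hsign, neg_one_mul] at hσv
    exact hvA (eq_zero_of_cycleType_extend (N := 15) (τ' := perm532) (by decide)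
      (by decide +kernel) noInvariantHarmonic_perm53 (by decide) (by decide) (by decide)
      (hct.trans cycleType_perm532.symm) hv hσv hA)
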